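/- Let $\mathbb{F}$ be a field of characteristic different from $2$, let $V$ be a finite-dimensional $\mathbb{F}$-vector space, let $b : V \times V \to \mathbb{F}$ be a non-degenerate symmetric bilinear form, and let $u \in \mathrm{O}(b)$ be an isometry of $b$ that is unipotent, i.e. $u-\mathrm{id}$ is nilpotent. Put $v := u+u^{-1}$. For every integer $l \geq 0$, let $(b,u)_{t-1,2l+1}$ be the bilinear form induced by $(x,y) \mapsto b\bigl(x,(v-2\,\mathrm{id})^l(y)\bigr)$ on the quotient space $$\operatorname{Ker}(u-\mathrm{id})^{2l+1}\Big/\Bigl(\operatorname{Ker}(u-\mathrm{id})^{2l}+\bigl(\operatorname{Im}(u-\mathrm{id}) \cap \operatorname{Ker}(u-\mathrm{id})^{2l+1}\bigr)\Bigr)$$ (the quadratic Wall invariant of $(b,u)$ attached to $(t-1,2l+1)$); it is well defined. Then the orthogonal sum $$\underset{l \geq 0}{\bot}\, (-1)^l\, (b,u)_{t-1,2l+1}$$ (only finitely many of whose summands have a nonzero underlying space) is a non-degenerate symmetric bilinear form, and $b$ is Witt-equivalent to it. Here, two non-degenerate symmetric bilinear forms $B$ and $C$ on finite-dimensional vector spaces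 over $\mathbb{F}$ are called Witt-equivalent when there are non-negative integers $m,n$ such that $B \bot H_{m}$ and $C \bot H_{n}$ are equivalent, where $H_n$ denotes the hyperbolic form $\bigl((f,x),(g,y)\bigr) \mapsto f(y)+g(x)$ on $(\mathbb{F}^n)^\star \times \mathbb{F}^n$. -/

import Mathlib

open scoped DirectSum

/-- A `1`-isopair on the `F`-vector space `V`: a non-degenerate symmetric bilinear form together
with an isometry of this form. -/
structure OneIsopair (F V : Type*) [Field F] [AddCommGroup V] [Module F V] where
  form : LinearMap.BilinForm F V
  isSymm : form.IsSymm
  nondegenerate : form.Nondegenerate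
  isometry : form.IsometryEquiv form

namespace OneIsopair

variable {F V : Type*} [Field F] [AddCommGroup V] [Module F V]

/-- The isometry `u`, as an endomorphism. -/
def u (P : OneIsopair F V) : Module.End F V := P.isometry.toLinearEquiv

/-- The inverse `u⁻¹`, as an endomorphism. -/
def uInv (P : OneIsopair F V) : Module.End F V := P.isometry.toLinearEquiv.symm

/-- The isopair is unipotent when `u - id` is nilpotent. -/
def IsUnipotent (P : OneIsopair F V) : Prop := IsNilpotent (P.u - 1)

theorem u_mul_uInv (P : OneIsopair F V) : P.u * P.uInv = 1 :=
  LinearMap.ext fun x => P.isometry.toLinearEquiv.apply_symm_apply x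

theorem uInv_mul_u (P : OneIsopair F V) : P.uInv * P.u = 1 :=
  LinearMap.ext fun x => P.isometry.toLinearEquiv.symm_apply_apply x

theorem form_u_u (P : OneIsopair F V) (x y : V) : P.form (P.u x) (P.u y) = P.form x y :=
  P.isometry.map_app' x y

theorem form_u_right (P : OneIsopair F V) (x y : V) :
    P.form x (P.u y) = P.form (P.uInv x) y := by
  rw [← P.form_u_u (P.uInv x) y, ← Module.End.mul_apply, u_mul_uInv, Module.End.one_apply]

theorem form_uInv_right (P : OneIsopair F V) (x y : V) :
    P.form x (P.uInv y) = P.form (P.u x) y := by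
  rw [← P.form_u_u x (P.uInv y), ← Module.End.mul_apply, u_mul_uInv, Module.End.one_apply]

/-- The endomorphism `v - 2 id`, where `v = u + u⁻¹`. -/
def vSubTwo (P : OneIsopair F V) : Module.End F V := P.u + P.uInv - 2

theorem form_vSubTwo_pow (P : OneIsopair F V) (k : ℕ) (x y : V) :
    P.form x ((P.vSubTwo ^ k) y) = P.form ((P.vSubTwo ^ k) x) y := by
  have h1 : ∀ x y, P.form x (P.vSubTwo y) = P.form (P.vSubTwo x) y := by
    intro x y
    have h2 : ∀ z : V, (2 : Module.End F V) z = z + z := by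
      intro z
      rw [← one_add_one_eq_two]; rfl
    simp only [vSubTwo, LinearMap.sub_apply, LinearMap.add_apply, map_sub, map_add, h2,
      form_u_right, form_uInv_right]
    ring
  induction k generalizing x y with
  | zero => rfl
  | succ k ih =>
    rw [pow_succ, Module.End.mul_apply, ih, h1, ← Module.End.mul_apply, ← pow_succ', pow_succ]

theorem vSubTwo_pow (P : OneIsopair F V) (k : ℕ) :
    P.vSubTwo ^ k = P.uInv ^ k * (P.u - 1) ^ (2 * k) := by
  have hc : Commute P.uInv P.u := by
    rw [Commute, SemiconjBy, u_mul_uInv, uInv_mul_u]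
  have h : P.vSubTwo = P.uInv * (P.u - 1) ^ 2 := by
    have e : P.uInv * (P.u - 1) ^ 2 = P.uInv * P.u * P.u - 2 * (P.uInv * P.u) + P.uInv := by
      noncomm_ring
    rw [e, uInv_mul_u, vSubTwo, one_mul, mul_one]
    abel
  rw [h, Commute.mul_pow, pow_mul]
  exact ((hc.sub_right (Commute.one_right _)).pow_right 2)

/-- The subspace `Ker (u - id)^(2k) + (im (u - id) ∩ Ker (u - id)^(2k+1))` of
`Ker (u - id)^(2k+1)`. -/
def wallRadical (P : OneIsopair F V) (k : ℕ) :
    Submodule F (LinearMap.ker ((P.u - 1) ^ (2 * k + 1))) :=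
  (LinearMap.ker ((P.u - 1) ^ (2 * k)) ⊔
    (LinearMap.range (P.u - 1) ⊓ LinearMap.ker ((P.u - 1) ^ (2 * k + 1)))).submoduleOf
      (LinearMap.ker ((P.u - 1) ^ (2 * k + 1)))

/-- The underlying space
`Ker (u - id)^(2k+1) / (Ker (u - id)^(2k) + (im (u - id) ∩ Ker (u - id)^(2k+1)))`
of the quadratic Wall invariant attached to `(t - 1, 2k + 1)`. -/
abbrev WallSpace (P : OneIsopair F V) (k : ℕ) : Type _ :=
  LinearMap.ker ((P.u - 1) ^ (2 * k + 1)) ⧸ P.wallRadical k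

/-- The bilinear form `(x, y) ↦ b(x, (v - 2 id)^k y)` on `Ker (u - id)^(2k+1)`. -/
def preWallForm (P : OneIsopair F V) (k : ℕ) :
    LinearMap.BilinForm F (LinearMap.ker ((P.u - 1) ^ (2 * k + 1))) :=
  P.form.compl₁₂ (LinearMap.ker ((P.u - 1) ^ (2 * k + 1))).subtype
    ((P.vSubTwo ^ k) ∘ₗ (LinearMap.ker ((P.u - 1) ^ (2 * k + 1))).subtype)

theorem preWallForm_apply (P : OneIsopair F V) (k : ℕ)
    (x y : LinearMap.ker ((P.u - 1) ^ (2 * k + 1))) :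
    P.preWallForm k x y = P.form x ((P.vSubTwo ^ k) y) := rfl

theorem preWallForm_symm (P : OneIsopair F V) (k : ℕ)
    (x y : LinearMap.ker ((P.u - 1) ^ (2 * k + 1))) :
    P.preWallForm k x y = P.preWallForm k y x := by
  rw [preWallForm_apply, preWallForm_apply, form_vSubTwo_pow, P.isSymm.eq]

theorem wallRadical_le_ker_flip (P : OneIsopair F V) (k : ℕ) :
    P.wallRadical k ≤ LinearMap.ker (P.preWallForm k).flip := by
  intro y hy
  rw [LinearMap.mem_ker]
  ext x
  change P.form x ((P.vSubTwo ^ k) y) = 0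
  obtain ⟨a, ha, c, ⟨⟨z, hz⟩, -⟩, hac⟩ := Submodule.mem_sup.1 (Submodule.mem_comap.1 hy)
  rw [Submodule.subtype_apply] at hac
  rw [← hac, map_add, map_add]
  have h1 : (P.vSubTwo ^ k) a = 0 := by
    rw [vSubTwo_pow, Module.End.mul_apply, LinearMap.mem_ker.1 ha, map_zero]
  have h2 : P.form x ((P.vSubTwo ^ k) c) = 0 := by
    have hx : ((P.u - 1) ^ (2 * k + 1)) (x : V) = 0 := x.2
    have hw : P.u ((P.vSubTwo ^ k) x) = (P.vSubTwo ^ k) x := by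
      have hc : Commute (P.u - 1) P.uInv := by
        refine Commute.sub_left ?_ (Commute.one_left _)
        rw [Commute, SemiconjBy, u_mul_uInv, uInv_mul_u]
      have h3 : (P.u - 1) * P.vSubTwo ^ k = P.uInv ^ k * (P.u - 1) ^ (2 * k + 1) := by
        rw [vSubTwo_pow, ← mul_assoc, (hc.pow_right k).eq, mul_assoc, ← pow_succ']
      have h4 : ((P.u - 1) * P.vSubTwo ^ k) x = 0 := by
        rw [h3, Module.End.mul_apply, hx, map_zero]
      exact sub_eq_zero.1 h4
    have hw' : P.uInv ((P.vSubTwo ^ k) x) = (P.vSubTwo ^ k) x := by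
      conv_lhs => rw [← hw]
      rw [← Module.End.mul_apply, uInv_mul_u, Module.End.one_apply]
    rw [form_vSubTwo_pow, ← hz, LinearMap.sub_apply, map_sub, form_u_right, hw',
      Module.End.one_apply, sub_self]
  rw [h1, h2, map_zero, add_zero]

theorem wallRadical_le_ker (P : OneIsopair F V) (k : ℕ) :
    P.wallRadical k ≤ LinearMap.ker (P.preWallForm k) := by
  intro x hx
  rw [LinearMap.mem_ker]
  ext y
  rw [preWallForm_symm]
  exact LinearMap.congr_fun (LinearMap.mem_ker.1 (P.wallRadical_le_ker_flip k hx)) y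

/-- The quadratic Wall invariant of the isopair attached to `(t - 1, 2k + 1)`: the bilinear form
induced by `(x, y) ↦ b(x, (v - 2 id)^k y)` on the quotient space `P.WallSpace k`. -/
def wallInvariant (P : OneIsopair F V) (k : ℕ) : LinearMap.BilinForm F (P.WallSpace k) :=
  LinearMap.liftQ₂ (P.wallRadical k) (P.wallRadical k) (P.preWallForm k)
    (P.wallRadical_le_ker k) (P.wallRadical_le_ker_flip k)

theorem wallInvariant_mk (P : OneIsopair F V) (k : ℕ)
    (x y : LinearMap.ker ((P.u - 1) ^ (2 * k + 1))) :
    P.wallInvariant k (Submodule.Quotient.mk x) (Submodule.Quotient.mk y) =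
      P.form x ((P.vSubTwo ^ k) y) := rfl

end OneIsopair

/-- The orthogonal sum of two bilinear forms. -/
def orthSum {F V W : Type*} [Field F] [AddCommGroup V] [Module F V] [AddCommGroup W] [Module F W]
    (B : LinearMap.BilinForm F V) (C : LinearMap.BilinForm F W) :
    LinearMap.BilinForm F (V × W) :=
  B.compl₁₂ (LinearMap.fst F V W) (LinearMap.fst F V W) +
    C.compl₁₂ (LinearMap.snd F V W) (LinearMap.snd F V W)

theorem orthSum_apply {F V W : Type*} [Field F] [AddCommGroup V] [Module F V] [AddCommGroup W]
    [Module F W] (B : LinearMap.BilinForm F V) (C : LinearMap.BilinForm F W) (x y : V × W) :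
    orthSum B C x y = B x.1 y.1 + C x.2 y.2 := rfl

/-- The orthogonal sum of a family of bilinear forms, on the direct sum of the underlying
spaces: it takes `(x, y)` to the sum of the `B i (x i) (y i)`. -/
def orthDirectSum {F ι : Type*} [Field F] [DecidableEq ι] {M : ι → Type*}
    [∀ i, AddCommGroup (M i)] [∀ i, Module F (M i)] (B : ∀ i, LinearMap.BilinForm F (M i)) :
    LinearMap.BilinForm F (⨁ i, M i) :=
  DirectSum.toModule F ι ((⨁ i, M i) →ₗ[F] F)
    fun i => (B i).compl₂ (DirectSum.component F ι M i)

theorem orthDirectSum_lof {F ι : Type*} [Field F] [DecidableEq ι] {M : ι → Type*}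
    [∀ i, AddCommGroup (M i)] [∀ i, Module F (M i)] (B : ∀ i, LinearMap.BilinForm F (M i))
    (i : ι) (x : M i) (y : ⨁ i, M i) :
    orthDirectSum B (DirectSum.lof F ι M i x) y = B i x (y i) := by
  rw [orthDirectSum, DirectSum.toModule_lof]
  rfl

/-- The standard hyperbolic symmetric bilinear form of rank `2 n`:
`((f, x), (g, y)) ↦ f(y) + g(x)` on the product of the dual of `F^n` with `F^n`. -/
abbrev hyperbolicForm (F : Type*) [Field F] (n : ℕ) :
    LinearMap.BilinForm F (Module.Dual F (Fin n → F) × (Fin n → F)) :=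
  LinearMap.dualProd F (Fin n → F)

/-- Witt-equivalence, a relation between non-degenerate symmetric bilinear forms: the forms become
equivalent after adding hyperbolic forms to both of them. -/
structure WittEquivalent {F V W : Type*} [Field F] [AddCommGroup V] [Module F V] [AddCommGroup W]
    [Module F W] (B : LinearMap.BilinForm F V) (C : LinearMap.BilinForm F W) : Prop where
  isSymm_left : B.IsSymm
  nondegenerate_left : B.Nondegenerate
  isSymm_right : C.IsSymm
  nondegenerate_right : C.Nondegenerate
  exists_equivalent : ∃ m n : ℕ,
    (orthSum B (hyperbolicForm F m)).Equivalent (orthSum C (hyperbolicForm F n))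

/-!
Let `N = u - id`, a nilpotent endomorphism. The adjoint of `N` for `b` is `u⁻¹ - id = -u⁻¹ N`, so
`im N^k` and `Ker N^k` are orthogonal to each other, `v - 2 id = u⁻¹ N^2`, and
`b(N^l x, N^l y) = (-1)^l b(x, (v - 2 id)^l y)` (`form_u_sub_one_pow_u_sub_one_pow`). Hence
`x ↦ N^l x` carries the form that defines the `l`-th Wall invariant, with the sign `(-1)^l`, to the
restriction of `b` to `N^l (Ker N^(2l+1)) = im N^l ∩ Ker N^(l+1)`. For distinct `l` these subspaces
are orthogonal.

Let `M` be their sum (`weightZero`). Its orthogonal `L` lies in every `Ker N^l + im N^(l+1)`, and,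
as `N` is nilpotent, the intersection of the latter lies in `M`
(`iInf_ker_sup_range_le_weightZero`). So `L` is totally isotropic with orthogonal `M`, and `M / L`
is the signed orthogonal sum of the Wall invariants. Each of these is non-degenerate because
`(Ker N^(2l+1))^⊥ = im N^(2l+1)` (`wallInvariant_nondegenerate`). Instead of passing to `M / L`, the
proof lifts the sum of the Wall spaces to a complement of `L` in `M` (`exists_isometric_section`).

In characteristic different from `2`, a non-degenerate form `b` with a totally isotropic `L` and a
complement `S` of `L` in `L^⊥` is the orthogonal sum of its restriction to `S` and a hyperbolic form
on `L* × L` (`exists_equivalent_of_isotropic`).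
-/

open LinearMap (BilinForm)

/-! ### Orthogonal sums of bilinear forms -/

section OrthogonalSums

variable {F : Type*} [Field F]

theorem orthDirectSum_apply_lof {ι : Type*} [DecidableEq ι] {M : ι → Type*}
    [∀ i, AddCommGroup (M i)] [∀ i, Module F (M i)] (B : ∀ i, BilinForm F (M i))
    (i : ι) (x : ⨁ i, M i) (y : M i) :
    orthDirectSum B x (DirectSum.lof F ι M i y) = B i (x i) y := by
  induction x using DirectSum.induction_on with
  | zero => simp
  | of j x =>
    rw [← DirectSum.lof_eq_of F, orthDirectSum_lof]
    by_cases h : i = j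
    · subst h
      rw [DirectSum.lof_apply, DirectSum.lof_apply]
    · rw [DirectSum.lof_eq_of, DirectSum.lof_eq_of, DirectSum.of_eq_of_ne _ _ _ h,
        DirectSum.of_eq_of_ne _ _ _ (Ne.symm h)]
      simp
  | add x x' hx hx' => rw [map_add, LinearMap.add_apply, hx, hx', DirectSum.add_apply, map_add,
      LinearMap.add_apply]

theorem orthDirectSum_isSymm {ι : Type*} [DecidableEq ι] {M : ι → Type*}
    [∀ i, AddCommGroup (M i)] [∀ i, Module F (M i)] {B : ∀ i, BilinForm F (M i)}
    (hB : ∀ i, (B i).IsSymm) : (orthDirectSum B).IsSymm := by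
  refine ⟨fun x y => ?_⟩
  induction x using DirectSum.induction_on with
  | zero => simp
  | of i x => rw [← DirectSum.lof_eq_of F, orthDirectSum_lof, orthDirectSum_apply_lof, (hB i).eq]
  | add x x' hx hx' => rw [map_add, LinearMap.add_apply, hx, hx', map_add]

theorem orthDirectSum_nondegenerate {ι : Type*} [DecidableEq ι] {M : ι → Type*}
    [∀ i, AddCommGroup (M i)] [∀ i, Module F (M i)] {B : ∀ i, BilinForm F (M i)}
    (hB : ∀ i, (B i).Nondegenerate) : (orthDirectSum B).Nondegenerate := by
  refine ⟨fun x hx => ?_, fun y hy => ?_⟩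
  · ext i : 1
    refine (hB i).1 _ fun y => ?_
    rw [← orthDirectSum_apply_lof, hx]
  · ext i : 1
    refine (hB i).2 _ fun x => ?_
    rw [← orthDirectSum_lof, hy]

/-- `hyperbolicForm F 0` lives on a zero space. -/
theorem equivalent_orthSum_hyperbolicForm_zero {V : Type*} [AddCommGroup V] [Module F V]
    (B : BilinForm F V) : (orthSum B (hyperbolicForm F 0)).Equivalent B := by
  let _ : Unique (Module.Dual F (Fin 0 → F) × (Fin 0 → F)) := uniqueOfSubsingleton 0
  refine ⟨⟨LinearEquiv.prodUnique, fun x y => ?_⟩⟩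
  change B x.1 y.1 = B x.1 y.1 + hyperbolicForm F 0 x.2 y.2
  rw [Subsingleton.elim x.2 0, map_zero, LinearMap.zero_apply, add_zero]

/-- The form `LinearMap.dualProd F L` is hyperbolic: a basis of `L` identifies it with the
standard hyperbolic form. -/
theorem exists_equivalent_orthSum_hyperbolicForm {W L : Type*} [AddCommGroup W] [Module F W]
    [AddCommGroup L] [Module F L] [FiniteDimensional F L] (C : BilinForm F W) :
    ∃ n : ℕ, (orthSum C (LinearMap.dualProd F L)).Equivalent
      (orthSum C (hyperbolicForm F n)) := by
  let e : L ≃ₗ[F] (Fin (Module.finrank F L) → F) := (Module.finBasis F L).equivFun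
  refine ⟨Module.finrank F L,
    ⟨⟨(LinearEquiv.refl F W).prodCongr (e.dualMap.symm.prodCongr e), fun x y => ?_⟩⟩⟩
  change C x.1 y.1 + (y.2.1 (e.symm (e x.2.2)) + x.2.1 (e.symm (e y.2.2))) =
    C x.1 y.1 + (y.2.1 x.2.2 + x.2.1 y.2.2)
  simp only [LinearEquiv.symm_apply_apply]

end OrthogonalSums

/-! ### Splitting off a hyperbolic form -/

section Splitting

variable {F V W : Type*} [Field F] [AddCommGroup V] [Module F V] [FiniteDimensional F V]
  [AddCommGroup W] [Module F W] {B : BilinForm F V} {C : BilinForm F W}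

/-- Linear functionals on `L` are represented, linearly, by vectors orthogonal to the image of
`Ψ`: by non-degeneracy of `C`, the image of `Ψ` and `L` are in direct sum, so that a functional
may be extended by zero. -/
theorem exists_dual_lift (hB : B.Nondegenerate) (hC : C.Nondegenerate) (Ψ : W →ₗ[F] V)
    (hΨ : ∀ x y, B (Ψ x) (Ψ y) = C x y) (L : Submodule F V) (hLΨ : ∀ x ∈ L, ∀ w, B x (Ψ w) = 0) :
    ∃ σ : Module.Dual F L →ₗ[F] V, (∀ f (x : L), B (σ f) x = f x) ∧ ∀ f w, B (σ f) (Ψ w) = 0 := by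
  let j : W × L →ₗ[F] V := Ψ.coprod L.subtype
  have hj : Function.Injective j := by
    rw [injective_iff_map_eq_zero]
    rintro ⟨w, x⟩ h
    have h' : Ψ w + x = 0 := h
    have hw : w = 0 := hC.1 _ fun w' => by
      have := congrArg (fun z => B z (Ψ w')) h'
      simpa [hΨ, hLΨ x x.2] using this
    subst hw
    rw [map_zero, zero_add] at h'
    exact Prod.ext rfl (Subtype.ext h')
  have hsurj : Function.Surjective (j.dualMap ∘ₗ (B.toDual hB).toLinearMap) :=
    (LinearMap.dualMap_surjective_of_injective hj).comp (B.toDual hB).surjective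
  obtain ⟨g, hg⟩ := LinearMap.exists_rightInverse_of_surjective _ (LinearMap.range_eq_top.2 hsurj)
  refine ⟨g ∘ₗ (LinearMap.snd F W L).dualMap, fun f x => ?_, fun f w => ?_⟩
  · have := LinearMap.congr_fun (LinearMap.congr_fun hg ((LinearMap.snd F W L).dualMap f)) (0, x)
    simpa [j, LinearMap.BilinForm.toDual_def] using this
  · have := LinearMap.congr_fun (LinearMap.congr_fun hg ((LinearMap.snd F W L).dualMap f)) (w, 0)
    simpa [j, LinearMap.BilinForm.toDual_def] using this

/-- In `exists_dual_lift`, the representing vectors may be chosen to span a totally isotropic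
subspace: when `2` is invertible, subtract from each of them the element of `L` that represents
half of its products with the others. -/
theorem exists_isotropic_dual_lift (h2 : (2 : F) ≠ 0) (hsymm : B.IsSymm) (hB : B.Nondegenerate)
    (hC : C.Nondegenerate) (Ψ : W →ₗ[F] V) (hΨ : ∀ x y, B (Ψ x) (Ψ y) = C x y)
    (L : Submodule F V) (hL : ∀ x ∈ L, ∀ y ∈ L, B x y = 0)
    (hLΨ : ∀ x ∈ L, ∀ w, B x (Ψ w) = 0) :
    ∃ τ : Module.Dual F L →ₗ[F] V, (∀ f (x : L), B (τ f) x = f x) ∧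
      (∀ f w, B (τ f) (Ψ w) = 0) ∧ ∀ f g, B (τ f) (τ g) = 0 := by
  obtain ⟨σ, hσL, hσΨ⟩ := exists_dual_lift hB hC Ψ hΨ L hLΨ
  let ρ : Module.Dual F L →ₗ[F] L :=
    (Module.evalEquiv F L).symm.toLinearMap ∘ₗ ((2 : F)⁻¹ • B.compl₁₂ σ σ)
  have hρ : ∀ f g : Module.Dual F L, g (ρ f) = 2⁻¹ * B (σ f) (σ g) := fun f g =>
    Module.apply_evalEquiv_symm_apply (R := F) (M := L) g _
  refine ⟨σ - L.subtype ∘ₗ ρ, fun f x => ?_, fun f w => ?_, fun f g => ?_⟩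
  · simp [hσL, hL _ (ρ f).2 _ x.2]
  · simp [hσΨ, hLΨ _ (ρ f).2]
  · have h1 : B (ρ f : V) (σ g) = 2⁻¹ * B (σ f) (σ g) := by rw [hsymm.eq, hσL, hρ]
    have h3 : B (σ f) (ρ g : V) = 2⁻¹ * B (σ f) (σ g) := by rw [hσL, hρ, hsymm.eq]
    simp only [LinearMap.sub_apply, map_sub, LinearMap.comp_apply, Submodule.subtype_apply, h1, h3,
      hL _ (ρ f).2 _ (ρ g).2]
    field_simp
    ring

/-- If a totally isotropic subspace `L` of a non-degenerate symmetric space is orthogonal to a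
non-degenerate subspace (the image of the isometric map `Ψ`) and the orthogonal of `L` is contained
in the sum of the two, then the form is the orthogonal sum of that subspace and a hyperbolic
form. -/
theorem exists_equivalent_of_isotropic (h2 : (2 : F) ≠ 0) (hsymm : B.IsSymm) (hB : B.Nondegenerate)
    (hC : C.Nondegenerate) (Ψ : W →ₗ[F] V) (hΨ : ∀ x y, B (Ψ x) (Ψ y) = C x y)
    (L : Submodule F V) (hL : ∀ x ∈ L, ∀ y ∈ L, B x y = 0)
    (hLΨ : ∀ x ∈ L, ∀ w, B x (Ψ w) = 0)
    (hLorth : ∀ x, (∀ y ∈ L, B x y = 0) → x ∈ LinearMap.range Ψ ⊔ L) :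
    ∃ n : ℕ, B.Equivalent (orthSum C (hyperbolicForm F n)) := by
  obtain ⟨τ, hτL, hτΨ, hττ⟩ := exists_isotropic_dual_lift h2 hsymm hB hC Ψ hΨ L hL hLΨ
  let Φ : W × (Module.Dual F L × L) →ₗ[F] V := Ψ.coprod (τ.coprod L.subtype)
  have hΦ' : ∀ w f x, Φ (w, f, x) = Ψ w + (τ f + x) := fun _ _ _ => rfl
  have hΦ : ∀ p q, B (Φ p) (Φ q) = orthSum C (LinearMap.dualProd F L) p q := by
    rintro ⟨w, f, x⟩ ⟨w', f', x'⟩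
    have e1 : B (Ψ w) (τ f') = 0 := by rw [hsymm.eq, hτΨ]
    have e2 : B (Ψ w) x' = 0 := by rw [hsymm.eq, hLΨ _ x'.2]
    have e3 : B x (τ f') = f' x := by rw [hsymm.eq, hτL]
    simp only [hΦ', map_add, LinearMap.add_apply, hΨ, e1, e2, e3, hτΨ, hττ, hτL,
      hLΨ _ x.2, hL _ x.2 _ x'.2, orthSum_apply, LinearMap.dualProd_apply_apply]
    ring
  have hinj : Function.Injective Φ := by
    rw [injective_iff_map_eq_zero]
    rintro ⟨w, f, x⟩ h
    have key (w' : W) (f' : Module.Dual F L) (x' : L) : C w w' + (f' x + f x') = 0 := by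
      have := hΦ (w, f, x) (w', f', x')
      rw [h, map_zero, LinearMap.zero_apply] at this
      exact this.symm
    have hw : w = 0 := hC.1 _ fun w' => by simpa using key w' 0 0
    have hf : f = 0 := LinearMap.ext fun x' => by simpa using key 0 0 x'
    have hx : x = 0 := (Module.forall_dual_apply_eq_zero_iff F x).1 fun f' => by
      simpa using key 0 f' 0
    rw [hw, hf, hx]; rfl
  have hsurj : Function.Surjective Φ := by
    intro v
    let f : Module.Dual F L := (B v).comp L.subtype
    obtain ⟨_, ⟨w, rfl⟩, x, hx, h⟩ := Submodule.mem_sup.1 <| hLorth (v - τ f) fun y hy => by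
      rw [map_sub, LinearMap.sub_apply, hτL f ⟨y, hy⟩]
      exact sub_self _
    refine ⟨(w, f, ⟨x, hx⟩), ?_⟩
    rw [hΦ', add_left_comm, h, add_sub_cancel]
  obtain ⟨n, hn⟩ := exists_equivalent_orthSum_hyperbolicForm (L := L) C
  have hE : (orthSum C (LinearMap.dualProd F L)).Equivalent B :=
    ⟨⟨LinearEquiv.ofBijective Φ ⟨hinj, hsurj⟩, hΦ⟩⟩
  exact ⟨n, hE.symm.trans hn⟩

end Splitting

/-! ### Kernels and images of the powers of `u - id` -/

namespace OneIsopair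

variable {F V : Type*} [Field F] [AddCommGroup V] [Module F V] (P : OneIsopair F V)

theorem uInv_pow_mul_u_sub_one_pow_eq_zero_iff (k m : ℕ) (x : V) :
    (P.uInv ^ k) (((P.u - 1) ^ m) x) = 0 ↔ ((P.u - 1) ^ m) x = 0 := by
  have h : P.u ^ k * P.uInv ^ k = 1 := by
    have hc : Commute P.u P.uInv := by rw [Commute, SemiconjBy, u_mul_uInv, uInv_mul_u]
    rw [← hc.mul_pow, u_mul_uInv, one_pow]
  refine ⟨fun h0 => ?_, fun h0 => by rw [h0, map_zero]⟩
  have := LinearMap.congr_fun h (((P.u - 1) ^ m) x)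
  rwa [Module.End.mul_apply, h0, map_zero, Module.End.one_apply, eq_comm] at this

/-- The adjoint of `u - id` is `u⁻¹ - id = -u⁻¹ (u - id)`. -/
theorem form_u_sub_one_pow_left (k : ℕ) (x y : V) :
    P.form (((P.u - 1) ^ k) x) y = (-1) ^ k * P.form x ((P.uInv ^ k) (((P.u - 1) ^ k) y)) := by
  have hc : Commute P.uInv (P.u - 1) := by
    refine Commute.sub_right ?_ (Commute.one_right _)
    rw [Commute, SemiconjBy, u_mul_uInv, uInv_mul_u]
  have h1 : ∀ x y, P.form ((P.u - 1) x) y = -P.form x (P.uInv ((P.u - 1) y)) := by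
    intro x y
    have : P.uInv (P.u y) = y := by rw [← Module.End.mul_apply, uInv_mul_u, Module.End.one_apply]
    simp only [LinearMap.sub_apply, Module.End.one_apply, map_sub, this, form_uInv_right]
    ring
  rw [← Module.End.mul_apply (P.uInv ^ k), ← hc.mul_pow]
  induction k generalizing x y with
  | zero => simp
  | succ k ih =>
    rw [pow_succ, Module.End.mul_apply, ih, h1, pow_succ' (P.uInv * (P.u - 1)),
      Module.End.mul_apply, pow_succ, ← Module.End.mul_apply P.uInv]
    ring

theorem form_eq_zero_of_mem_range_of_mem_ker {k : ℕ} {x y : V}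
    (hx : x ∈ LinearMap.range ((P.u - 1) ^ k)) (hy : y ∈ LinearMap.ker ((P.u - 1) ^ k)) :
    P.form x y = 0 := by
  obtain ⟨z, rfl⟩ := hx
  rw [form_u_sub_one_pow_left, LinearMap.mem_ker.1 hy, map_zero, map_zero, mul_zero]

theorem range_u_sub_one_pow_antitone :
    Antitone fun k => LinearMap.range ((P.u - 1) ^ k) := by
  intro k m h
  rintro _ ⟨x, rfl⟩
  refine ⟨((P.u - 1) ^ (m - k)) x, ?_⟩
  rw [← Module.End.mul_apply, ← pow_add, Nat.add_sub_cancel' h]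

theorem ker_u_sub_one_pow_monotone :
    Monotone fun k => LinearMap.ker ((P.u - 1) ^ k) := by
  intro k m h x hx
  change ((P.u - 1) ^ m) x = 0
  rw [← Nat.sub_add_cancel h, pow_add, Module.End.mul_apply, LinearMap.mem_ker.1 hx, map_zero]

theorem orthogonal_range_u_sub_one_pow (k : ℕ) :
    P.form.orthogonal (LinearMap.range ((P.u - 1) ^ k)) = LinearMap.ker ((P.u - 1) ^ k) := by
  ext y
  refine ⟨fun hy => ?_, fun hy x hx => P.form_eq_zero_of_mem_range_of_mem_ker hx hy⟩
  rw [LinearMap.mem_ker, ← P.uInv_pow_mul_u_sub_one_pow_eq_zero_iff k]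
  refine P.nondegenerate.2 _ fun x => ?_
  have h : P.form (((P.u - 1) ^ k) x) y = 0 := hy _ ⟨x, rfl⟩
  rw [form_u_sub_one_pow_left] at h
  exact (mul_eq_zero.1 h).resolve_left (pow_ne_zero _ (neg_ne_zero.2 one_ne_zero))

theorem orthogonal_ker_u_sub_one_pow [FiniteDimensional F V] (k : ℕ) :
    P.form.orthogonal (LinearMap.ker ((P.u - 1) ^ k)) = LinearMap.range ((P.u - 1) ^ k) := by
  rw [← orthogonal_range_u_sub_one_pow,
    BilinForm.orthogonal_orthogonal P.nondegenerate P.isSymm.isRefl]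

/-- The map `(u - id)^l` carries the form that defines the Wall invariant to `(-1)^l b`. -/
theorem form_u_sub_one_pow_u_sub_one_pow (l : ℕ) (x y : V) :
    P.form (((P.u - 1) ^ l) x) (((P.u - 1) ^ l) y) = (-1) ^ l * P.form x ((P.vSubTwo ^ l) y) := by
  rw [form_u_sub_one_pow_left, vSubTwo_pow, Module.End.mul_apply, two_mul, pow_add,
    Module.End.mul_apply]

theorem u_sub_one_pow_mem_weightPiece {l : ℕ} (x : LinearMap.ker ((P.u - 1) ^ (2 * l + 1))) :
    ((P.u - 1) ^ l) (x : V) ∈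
      LinearMap.range ((P.u - 1) ^ l) ⊓ LinearMap.ker ((P.u - 1) ^ (l + 1)) := by
  refine ⟨⟨x, rfl⟩, LinearMap.mem_ker.2 ?_⟩
  rw [← Module.End.mul_apply, ← pow_add, show l + 1 + l = 2 * l + 1 by ring]
  exact x.2

theorem exists_of_mem_weightPiece {l : ℕ} {z : V} (hz : z ∈
    LinearMap.range ((P.u - 1) ^ l) ⊓ LinearMap.ker ((P.u - 1) ^ (l + 1))) :
    ∃ x : LinearMap.ker ((P.u - 1) ^ (2 * l + 1)), ((P.u - 1) ^ l) (x : V) = z := by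
  obtain ⟨⟨x, rfl⟩, hx⟩ := hz
  refine ⟨⟨x, ?_⟩, rfl⟩
  rw [LinearMap.mem_ker, show 2 * l + 1 = l + 1 + l by ring, pow_add, Module.End.mul_apply]
  exact hx

theorem form_eq_zero_of_mem_weightPiece {l m : ℕ} (h : l ≠ m) {x y : V}
    (hx : x ∈ LinearMap.range ((P.u - 1) ^ l) ⊓ LinearMap.ker ((P.u - 1) ^ (l + 1)))
    (hy : y ∈ LinearMap.range ((P.u - 1) ^ m) ⊓ LinearMap.ker ((P.u - 1) ^ (m + 1))) :
    P.form x y = 0 := by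
  rcases lt_or_gt_of_ne h with h | h
  · rw [P.isSymm.eq]
    exact P.form_eq_zero_of_mem_range_of_mem_ker (P.range_u_sub_one_pow_antitone h hy.1) hx.2
  · exact P.form_eq_zero_of_mem_range_of_mem_ker (P.range_u_sub_one_pow_antitone h hx.1) hy.2

/-! ### The weight filtration -/

/-- The sum of the subspaces `im (u - id)^l ∩ Ker (u - id)^(l+1)`: the part of weight `≤ 0` of the
monodromy filtration of the nilpotent endomorphism `u - id`. -/
def weightZero : Submodule F V :=
  ⨆ l : ℕ, LinearMap.range ((P.u - 1) ^ l) ⊓ LinearMap.ker ((P.u - 1) ^ (l + 1))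

theorem weightPiece_le_weightZero (l : ℕ) :
    LinearMap.range ((P.u - 1) ^ l) ⊓ LinearMap.ker ((P.u - 1) ^ (l + 1)) ≤ P.weightZero :=
  le_iSup (fun l : ℕ => LinearMap.range ((P.u - 1) ^ l) ⊓ LinearMap.ker ((P.u - 1) ^ (l + 1))) l

/-- Taking orthogonals exchanges `im (u - id)^k` and `Ker (u - id)^k`, and sums and
intersections. -/
theorem orthogonal_weightPiece_le [FiniteDimensional F V] (l : ℕ) :
    P.form.orthogonal (LinearMap.range ((P.u - 1) ^ l) ⊓ LinearMap.ker ((P.u - 1) ^ (l + 1))) ≤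
      LinearMap.ker ((P.u - 1) ^ l) ⊔ LinearMap.range ((P.u - 1) ^ (l + 1)) := by
  rw [← BilinForm.orthogonal_orthogonal P.nondegenerate P.isSymm.isRefl
    (LinearMap.ker ((P.u - 1) ^ l) ⊔ LinearMap.range ((P.u - 1) ^ (l + 1)))]
  refine BilinForm.orthogonal_le (le_inf ?_ ?_)
  · rw [← P.orthogonal_ker_u_sub_one_pow l]
    exact BilinForm.orthogonal_le le_sup_left
  · rw [← P.orthogonal_range_u_sub_one_pow (l + 1)]
    exact BilinForm.orthogonal_le le_sup_right

/-- A statement about the two chains of subspaces `Ker (u - id)^l` and `im (u - id)^l` only: it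
follows from the modular law, since the second chain reaches zero. -/
theorem iInf_ker_sup_range_le_weightZero (hP : P.IsUnipotent) {x : V}
    (hx : ∀ l, x ∈ LinearMap.ker ((P.u - 1) ^ l) ⊔ LinearMap.range ((P.u - 1) ^ (l + 1))) :
    x ∈ P.weightZero := by
  -- Modulo elements of `weightZero` killed by `(u - id)^l`, push `x` into `im (u - id)^l`.
  have key : ∀ l, ∃ m ∈ P.weightZero ⊓ LinearMap.ker ((P.u - 1) ^ l),
      x - m ∈ LinearMap.range ((P.u - 1) ^ l) := by
    intro l
    induction l with
    | zero => exact ⟨0, zero_mem _, x, by simp⟩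
    | succ l ih =>
      obtain ⟨m, ⟨hm, hmK⟩, hmI⟩ := ih
      obtain ⟨a, ha, c, hc, rfl⟩ := Submodule.mem_sup.1 (hx l)
      have hcI := P.range_u_sub_one_pow_antitone l.le_succ hc
      have hK : a - m ∈ LinearMap.ker ((P.u - 1) ^ (l + 1)) :=
        P.ker_u_sub_one_pow_monotone l.le_succ (sub_mem ha hmK)
      have hI : a - m ∈ LinearMap.range ((P.u - 1) ^ l) := by
        have := sub_mem hmI hcI
        rwa [show a + c - m - c = a - m by abel] at this
      refine ⟨a, ⟨?_, P.ker_u_sub_one_pow_monotone l.le_succ ha⟩, by simpa using hc⟩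
      rw [← sub_add_cancel a m]
      exact add_mem (P.weightPiece_le_weightZero l ⟨hI, hK⟩) hm
  obtain ⟨n, hn⟩ := hP
  obtain ⟨m, ⟨hm, -⟩, z, hz⟩ := key n
  rw [hn, LinearMap.zero_apply] at hz
  rwa [sub_eq_zero.1 hz.symm]

/-- The orthogonal of `weightZero` is totally isotropic. -/
theorem orthogonal_weightZero_le [FiniteDimensional F V] (hP : P.IsUnipotent) :
    P.form.orthogonal P.weightZero ≤ P.weightZero := fun _ hx =>
  P.iInf_ker_sup_range_le_weightZero hP fun l =>
    P.orthogonal_weightPiece_le l (BilinForm.orthogonal_le (P.weightPiece_le_weightZero l) hx)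

/-! ### The Wall invariants -/

theorem wallInvariant_isSymm (k : ℕ) : (P.wallInvariant k).IsSymm := by
  refine ⟨fun x y => ?_⟩
  obtain ⟨x, rfl⟩ := Submodule.Quotient.mk_surjective _ x
  obtain ⟨y, rfl⟩ := Submodule.Quotient.mk_surjective _ y
  exact P.preWallForm_symm k x y

/-- If `(v - 2 id)^k y` is orthogonal to `Ker (u - id)^(2k+1)`, it lies in `im (u - id)^(2k+1)`, so
that `(u - id)^(2k) y = (u - id)^(2k+1) z` for some `z`. Then `y` is the sum of
`y - (u - id) z`, killed by `(u - id)^(2k)`, and of `(u - id) z`. -/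
theorem wallInvariant_nondegenerate [FiniteDimensional F V] (k : ℕ) :
    (P.wallInvariant k).Nondegenerate := by
  have hr : (P.wallInvariant k).SeparatingRight := by
    intro y hy
    obtain ⟨y, rfl⟩ := Submodule.Quotient.mk_surjective _ y
    rw [Submodule.Quotient.mk_eq_zero]
    have h1 : (P.vSubTwo ^ k) y ∈ P.form.orthogonal (LinearMap.ker ((P.u - 1) ^ (2 * k + 1))) :=
      fun x hx => hy (Submodule.Quotient.mk ⟨x, hx⟩)
    -- `u` preserves `im (u - id)^(2k+1)`, so the factor `u⁻¹ ^ k` of `(v - 2 id)^k` drops out.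
    have h2 : ((P.u - 1) ^ (2 * k)) (y : V) ∈ LinearMap.range ((P.u - 1) ^ (2 * k + 1)) := by
      rw [orthogonal_ker_u_sub_one_pow, vSubTwo_pow] at h1
      obtain ⟨z, hz⟩ := h1
      have hc : Commute P.u P.uInv := by rw [Commute, SemiconjBy, u_mul_uInv, uInv_mul_u]
      have hcu : Commute (P.u ^ k) ((P.u - 1) ^ (2 * k + 1)) :=
        ((Commute.refl P.u).sub_right (Commute.one_right _)).pow_pow _ _
      refine ⟨(P.u ^ k) z, ?_⟩
      rw [← Module.End.mul_apply, ← hcu.eq, Module.End.mul_apply, hz, ← Module.End.mul_apply,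
        ← mul_assoc, ← hc.mul_pow, u_mul_uInv, one_pow, one_mul]
    obtain ⟨z, hz⟩ := h2
    have hd : (y : V) - (P.u - 1) z ∈ LinearMap.ker ((P.u - 1) ^ (2 * k)) := by
      rw [LinearMap.mem_ker, map_sub, ← hz, pow_succ, Module.End.mul_apply, sub_self]
    refine Submodule.mem_comap.2 (Submodule.mem_sup.2 ⟨_, hd, (P.u - 1) z, ⟨⟨z, rfl⟩, ?_⟩,
      sub_add_cancel _ _⟩)
    have := sub_mem y.2 (P.ker_u_sub_one_pow_monotone (2 * k).le_succ hd)
    rwa [sub_sub_cancel] at this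
  exact ⟨fun x hx => hr x fun y => by rw [(P.wallInvariant_isSymm k).eq, hx], hr⟩

theorem smul_wallInvariant_isSymm (k : ℕ) : ((-1 : F) ^ k • P.wallInvariant k).IsSymm :=
  ⟨fun x y => congrArg ((-1 : F) ^ k * ·) ((P.wallInvariant_isSymm k).eq x y)⟩

theorem smul_wallInvariant_nondegenerate [FiniteDimensional F V] (k : ℕ) :
    ((-1 : F) ^ k • P.wallInvariant k).Nondegenerate := by
  have h0 : ((-1 : F) ^ k) ≠ 0 := pow_ne_zero _ (neg_ne_zero.2 one_ne_zero)
  exact ⟨fun x hx => (P.wallInvariant_nondegenerate k).1 x fun y =>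
      (mul_eq_zero.1 (hx y)).resolve_left h0,
    fun y hy => (P.wallInvariant_nondegenerate k).2 y fun x =>
      (mul_eq_zero.1 (hy x)).resolve_left h0⟩

/-- The map `(u - id)^l` sends the radical of the form that defines the Wall invariant to the
radical of `weightZero`. -/
theorem u_sub_one_pow_mem_orthogonal_weightZero {l : ℕ}
    {y : LinearMap.ker ((P.u - 1) ^ (2 * l + 1))} (hy : y ∈ P.wallRadical l) :
    ((P.u - 1) ^ l) (y : V) ∈ P.form.orthogonal P.weightZero := by
  have h : P.weightZero ≤ LinearMap.ker (P.form.flip (((P.u - 1) ^ l) (y : V))) := by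
    refine iSup_le fun m z hz => ?_
    change P.form z (((P.u - 1) ^ l) (y : V)) = 0
    by_cases hml : m = l
    · subst hml
      obtain ⟨x, rfl⟩ := P.exists_of_mem_weightPiece hz
      have := LinearMap.congr_fun (LinearMap.mem_ker.1 (P.wallRadical_le_ker_flip m hy)) x
      rw [form_u_sub_one_pow_u_sub_one_pow]
      exact mul_eq_zero_of_right _ this
    · exact P.form_eq_zero_of_mem_weightPiece hml hz (P.u_sub_one_pow_mem_weightPiece y)
  exact fun z hz => h hz

/-- Lifting the Wall spaces to the kernels `Ker (u - id)^(2l+1)` and applying `(u - id)^l` embeds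
the signed orthogonal sum of the Wall invariants isometrically as a complement of the radical of
`weightZero`. -/
theorem exists_isometric_section [FiniteDimensional F V] :
    ∃ Ψ : (⨁ l, P.WallSpace l) →ₗ[F] V,
      (∀ x y, P.form (Ψ x) (Ψ y) =
        orthDirectSum (fun l : ℕ => ((-1 : F) ^ l) • P.wallInvariant l) x y) ∧
      (∀ x, Ψ x ∈ P.weightZero) ∧
      P.weightZero ≤ LinearMap.range Ψ ⊔ P.form.orthogonal P.weightZero := by
  choose s hs using fun l => LinearMap.exists_rightInverse_of_surjective
    (P.wallRadical l).mkQ (Submodule.range_mkQ _)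
  have hs' : ∀ l x, Submodule.Quotient.mk (s l x) = x := fun l x => LinearMap.congr_fun (hs l) x
  let Ψ : (⨁ l, P.WallSpace l) →ₗ[F] V := DirectSum.toModule F ℕ V fun l =>
    ((P.u - 1) ^ l) ∘ₗ (LinearMap.ker ((P.u - 1) ^ (2 * l + 1))).subtype ∘ₗ s l
  have hΨ : ∀ l x, Ψ (DirectSum.lof F ℕ P.WallSpace l x) = ((P.u - 1) ^ l) (s l x : V) :=
    fun l x => DirectSum.toModule_lof F l x
  refine ⟨Ψ, fun x y => ?_, fun x => ?_, iSup_le fun l z hz => ?_⟩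
  · induction x using DirectSum.induction_on with
    | zero => simp
    | add x x' hx hx' => simp only [map_add, LinearMap.add_apply, hx, hx']
    | of l x =>
      induction y using DirectSum.induction_on with
      | zero => simp
      | add y y' hy hy' => simp only [map_add, hy, hy']
      | of m y =>
        rw [← DirectSum.lof_eq_of F, ← DirectSum.lof_eq_of F, orthDirectSum_lof, hΨ, hΨ]
        by_cases h : l = m
        · subst h
          rw [DirectSum.lof_apply, form_u_sub_one_pow_u_sub_one_pow, ← wallInvariant_mk, hs', hs']
          rfl
        · rw [P.form_eq_zero_of_mem_weightPiece h (P.u_sub_one_pow_mem_weightPiece _)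
            (P.u_sub_one_pow_mem_weightPiece _), DirectSum.lof_eq_of,
            DirectSum.of_eq_of_ne _ _ _ h, map_zero]
  · induction x using DirectSum.induction_on with
    | zero => rw [map_zero]; exact zero_mem _
    | add x x' hx hx' => rw [map_add]; exact add_mem hx hx'
    | of l x =>
      rw [← DirectSum.lof_eq_of F, hΨ]
      exact P.weightPiece_le_weightZero l (P.u_sub_one_pow_mem_weightPiece _)
  · obtain ⟨x, rfl⟩ := P.exists_of_mem_weightPiece hz
    have hr : x - s l (Submodule.Quotient.mk x) ∈ P.wallRadical l := by
      rw [← Submodule.Quotient.mk_eq_zero, Submodule.Quotient.mk_sub, hs', sub_self]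
    refine Submodule.mem_sup.2 ⟨_, ⟨DirectSum.lof F ℕ P.WallSpace l (Submodule.Quotient.mk x), rfl⟩,
      _, P.u_sub_one_pow_mem_orthogonal_weightZero hr, ?_⟩
    rw [hΨ, ← map_add, Submodule.coe_sub, add_sub_cancel]

end OneIsopair

theorem mainTheorem8 {F V : Type*} [Field F] (hF : ringChar F ≠ 2)
    [AddCommGroup V] [Module F V] [FiniteDimensional F V]
    (P : OneIsopair F V) (hP : P.IsUnipotent) :
    WittEquivalent P.form
      (orthDirectSum fun l : ℕ => ((-1 : F) ^ l) • P.wallInvariant l) := by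
  have hC := orthDirectSum_nondegenerate P.smul_wallInvariant_nondegenerate
  -- The form `b` itself contains the hyperbolic part, so nothing has to be added to it.
  refine ⟨P.isSymm, P.nondegenerate, orthDirectSum_isSymm P.smul_wallInvariant_isSymm, hC, 0, ?_⟩
  obtain ⟨Ψ, hΨ, hΨM, hM⟩ := P.exists_isometric_section
  have hL := P.orthogonal_weightZero_le hP
  obtain ⟨n, hn⟩ := exists_equivalent_of_isotropic (Ring.two_ne_zero hF) P.isSymm P.nondegenerate
    hC Ψ hΨ (P.form.orthogonal P.weightZero) (fun x hx y hy => hy x (hL hx))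
    (fun x hx w => by rw [P.isSymm.eq]; exact hx _ (hΨM w)) fun x hx => hM <| by
      rw [← LinearMap.BilinForm.orthogonal_orthogonal P.nondegenerate P.isSymm.isRefl P.weightZero]
      exact fun y hy => (P.isSymm.eq y x).trans (hx y hy)
  exact ⟨n, (equivalent_orthSum_hyperbolicForm_zero _).trans hn⟩
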